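/- Let $f(x)$ be one of the functions $e^x$, $\ln x$, $\sin x$, $\cos x$, $\tan x$, $\csc x$, $\sec x$, $\cot x$, $\sinh x$, $\cosh x$, $\tanh x$, $\coth x$ of a complex variable $x$, where $\ln$ denotes any branch of the complex logarithm, i.e. $\ln x = \operatorname{Log} x + 2\pi i k$ for a fixed $k \in \mathbb{Z}$, with $\operatorname{Log}$ the principal branch. Let $g(t) \in \mathbb{Q}[t]$ be a non-constant polynomial and let $h(x) \in \mathbb{Q}[x]$. Let $\alpha \in \mathbb{C}$ be a solution of the equation $$g(f(x)) = h(x),$$ that is, $f$ is defined at $\alpha$ and $g(f(\alpha)) = h(\alpha)$. Assume that $\alpha \neq 0$ and, if $f$ is the principal branch of the logarithm, that also $\alpha \neq 1$. Then $\alpha$ is transcendental over $\mathbb{Q}$. -/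

import Mathlib

/-- The functions under consideration, as functions of one complex variable. The logarithm comes
with an integer that selects its branch; `log 0` is the principal branch, which extends the real
natural logarithm. -/
inductive ElemFun where
  | exp
  | log (k : ℤ)
  | sin
  | cos
  | tan
  | csc
  | sec
  | cot
  | sinh
  | cosh
  | tanh
  | coth

namespace ElemFun

/-- The set of complex numbers at which the function is defined. -/
def domain : ElemFun → Set ℂ
  | exp => Set.univ
  | log _ => {z | z ≠ 0}
  | sin => Set.univ
  | cos => Set.univ
  | tan => {z | Complex.cos z ≠ 0}
  | csc => {z | Complex.sin z ≠ 0}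
  | sec => {z | Complex.cos z ≠ 0}
  | cot => {z | Complex.sin z ≠ 0}
  | sinh => Set.univ
  | cosh => Set.univ
  | tanh => {z | Complex.cosh z ≠ 0}
  | coth => {z | Complex.sinh z ≠ 0}

/-- The value of the function at a complex number (meaningful on `domain`). -/
noncomputable def eval : ElemFun → ℂ → ℂ
  | exp, z => Complex.exp z
  | log k, z => Complex.log z + 2 * Real.pi * Complex.I * k
  | sin, z => Complex.sin z
  | cos, z => Complex.cos z
  | tan, z => Complex.tan z
  | csc, z => 1 / Complex.sin z
  | sec, z => 1 / Complex.cos z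
  | cot, z => Complex.cot z
  | sinh, z => Complex.sinh z
  | cosh, z => Complex.cosh z
  | tanh, z => Complex.tanh z
  | coth, z => Complex.cosh z / Complex.sinh z

/-- `α` is a solution of the equation `g(f(x)) = h(x)`: the function `f` is defined at `α`, and the
equation holds there. -/
def IsSolution (f : ElemFun) (g h : Polynomial ℚ) (α : ℂ) : Prop :=
  α ∈ f.domain ∧ Polynomial.aeval (f.eval α) g = Polynomial.aeval α h

end ElemFun

/-!
The theorem reduces to the Hermite–Lindemann theorem: `exp a` is transcendental for every nonzero
algebraic `a` (`transcendental_exp_of_isAlgebraic`). Suppose that `α` is algebraic. Then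
`g (f α) = h α` is algebraic, and since `g` is not constant, so is `f α`. But each of the functions
takes transcendental values at nonzero algebraic points (`ElemFun.transcendental_eval`): if a
trigonometric function of `α` is algebraic, so are `cos α` and `sin α`, hence also `exp (α * I)`;
the hyperbolic functions are trigonometric functions of `α * I`; and `exp` undoes every branch of
the logarithm, so a nonzero value of the logarithm at an algebraic point is transcendental. The
only zero of a branch of the logarithm is the zero of the principal branch at `1`.

For the Hermite–Lindemann theorem, let `K` be a Galois number field in `ℂ` containing `a`. An
integral polynomial relation for `exp a` is a nonzero element `F` of the group ring `ℤ[K]` of the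
additive group of `K` that is killed by the evaluation sending the basis element of `x` to `exp x`.
The group ring has no zero divisors, because `K` is torsion free. Hence the product of the Galois
conjugates of `F` is again nonzero; it is Galois invariant and also killed by evaluation.
Multiplying it by the orbit sum of `-y`, with `y` a point of its support, produces an invariant
relation whose coefficient at `0` does not vanish.

Such a relation is impossible (`sum_exp_ne_zero_of_galois_invariant`). By
`LindemannWeierstrass.exp_polynomial_approx`, for every large prime `p` there are an integer `n`
prime to `p` and an integral polynomial `q` such that `n * exp x` is within `c ^ p / (p - 1)!` of
`p * q x` at all nonzero exponents `x`. Replacing the exponentials by these approximants turns the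
relation `A + ∑ F x * exp x = 0` into the statement that `n * A + p * ∑ F x * q x` is very small.
By Galois invariance the sum is rational, so that after multiplication by a power of a common
denominator `b` of the exponents the whole expression is an integer, smaller than `1` in absolute
value, hence `0`. Then `p` divides a power of `b` times `n * A`, which fails for large `p`.
-/

/-! ### Integrality and growth -/

open Polynomial in
/-- If `b` is a denominator of `x`, then `b ^ m` is a denominator of every integral polynomial
expression in `x` of degree at most `m`. -/
theorem IsIntegral.pow_mul_aeval {K : Type*} [Field K] {b : ℤ} {x : K}
    (hx : IsIntegral ℤ (b * x)) (g : ℤ[X]) {m : ℕ} (hm : g.natDegree ≤ m) :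
    IsIntegral ℤ ((b : K) ^ m * aeval x g) := by
  rw [aeval_eq_sum_range' (Nat.lt_succ_of_le hm), Finset.mul_sum]
  refine IsIntegral.sum _ fun i hi => ?_
  have him : i ≤ m := Nat.lt_succ_iff.mp (Finset.mem_range.mp hi)
  have : (b : K) ^ m * g.coeff i • x ^ i
      = ((b ^ (m - i) * g.coeff i : ℤ) : K) * (b * x) ^ i := by
    rw [zsmul_eq_mul, mul_pow, ← Nat.sub_add_cancel him, pow_add, Nat.add_sub_cancel]
    push_cast
    ring
  rw [this]
  exact (isIntegral_algebraMap (R := ℤ) (A := K) (x := _)).mul (hx.pow i)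

/-- In a Galois number field, a Galois-invariant algebraic integer is a rational integer. -/
theorem exists_intCast_eq_of_isIntegral_of_fixed {K : Type*} [Field K] [Algebra ℚ K]
    [FiniteDimensional ℚ K] [IsGalois ℚ K] {x : K} (hx : IsIntegral ℤ x)
    (hfix : ∀ σ : K ≃ₐ[ℚ] K, σ x = x) : ∃ k : ℤ, (k : K) = x := by
  obtain ⟨q, rfl⟩ := IntermediateField.mem_bot.mp ((IsGalois.mem_bot_iff_fixed x).mpr hfix)
  rw [isIntegral_algebraMap_iff (algebraMap ℚ K).injective] at hx
  obtain ⟨k, rfl⟩ := IsIntegrallyClosed.isIntegral_iff.mp hx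
  exact ⟨k, by simp⟩

/-- The error `c ^ p / (p - 1)!` of the approximation of exponentials beats the denominators, which
grow like `B ^ (p * d)`. -/
theorem exists_large_prime_pow_div_factorial_lt (B C c : ℝ) (d N : ℕ) :
    ∃ p : ℕ, p.Prime ∧ N < p ∧ B ^ (p * d) * (C * (c ^ p / (p - 1).factorial)) < 1 := by
  have h := (FloorSemiring.tendsto_pow_div_factorial_atTop (B ^ d * c)).const_mul
    (C * (B ^ d * c))
  rw [mul_zero] at h
  obtain ⟨M, hM⟩ := Filter.eventually_atTop.mp (h.eventually_lt_const one_pos)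
  obtain ⟨p, hp, hprime⟩ := Nat.exists_infinite_primes (M + N + 1)
  refine ⟨p, hprime, by omega, ?_⟩
  convert! hM (p - 1) (by omega) using 1
  obtain ⟨q, rfl⟩ : ∃ q, p = q + 1 := ⟨p - 1, by omega⟩
  rw [Nat.add_sub_cancel]
  ring

/-! ### Galois-invariant relations between exponentials -/

open Polynomial in
/-- The arithmetic core: the finite support of `F` is a Galois-stable set of exponents, `F` is
constant on its orbits, and the exponent `0` occurs. -/
theorem sum_exp_ne_zero_of_galois_invariant {K : Type*} [Field K] [Algebra ℚ K]
    [FiniteDimensional ℚ K] [IsGalois ℚ K] (φ : K →+* ℂ) (F : K →₀ ℤ)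
    (hF : ∀ (σ : K ≃ₐ[ℚ] K) x, F (σ x) = F x) (h0 : F 0 ≠ 0) :
    F.sum (fun x c => (c : ℂ) * Complex.exp (φ x)) ≠ 0 := by
  classical
  intro hsum
  have : CharZero K := algebraRat.charZero K
  set S := F.support.erase 0 with hS
  have hrel : (F 0 : ℂ) + ∑ x ∈ S, (F x : ℂ) * Complex.exp (φ x) = 0 := by
    rw [← hsum, Finsupp.sum,
      ← Finset.add_sum_erase _ _ (Finsupp.mem_support_iff.mpr h0), map_zero φ, Complex.exp_zero,
      mul_one]
  have hpoly : ∀ x : K, ∃ q : ℤ[X], x ≠ 0 → q.coeff 0 ≠ 0 ∧ aeval x q = 0 := by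
    intro x
    by_cases hx : x = 0
    · exact ⟨0, fun h => absurd hx h⟩
    · have halg : IsAlgebraic ℤ x :=
        (IsFractionRing.isAlgebraic_iff ℤ ℚ K).mpr (Algebra.IsAlgebraic.isAlgebraic x)
      obtain ⟨q, hq⟩ :=
        halg.exists_nonzero_coeff_and_aeval_eq_zero (mem_nonZeroDivisors_of_ne_zero hx)
      exact ⟨q, fun _ => hq⟩
  choose q hq using hpoly
  -- The approximation theorem needs one integral polynomial that vanishes at all nonzero exponents
  -- but not at `0`.
  set f : ℤ[X] := ∏ x ∈ S, q x with hf
  have hf0 : f.eval 0 ≠ 0 := by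
    rw [hf, eval_prod, Finset.prod_ne_zero_iff]
    intro x hx
    rw [← coeff_zero_eq_eval_zero]
    exact (hq x (Finset.ne_of_mem_erase hx)).1
  have hfne : f ≠ 0 := by rintro h; simp [h] at hf0
  have hroot : ∀ x ∈ S, aeval x f = 0 := by
    intro x hx
    rw [hf, map_prod]
    exact Finset.prod_eq_zero hx (hq x (Finset.ne_of_mem_erase hx)).2
  set b := f.leadingCoeff with hb
  have hb0 : b ≠ 0 := leadingCoeff_ne_zero.mpr hfne
  have hint : ∀ x ∈ S, IsIntegral ℤ ((b : K) * x) := by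
    intro x hx
    simpa [zsmul_eq_mul] using isIntegral_leadingCoeff_smul f x (hroot x hx)
  obtain ⟨c, hc⟩ := LindemannWeierstrass.exp_polynomial_approx f hf0
  obtain ⟨p, hp, hplarge, hsmall⟩ := exists_large_prime_pow_div_factorial_lt |(b : ℝ)|
    (∑ x ∈ S, |(F x : ℝ)|) c f.natDegree ((f.eval 0).natAbs + b.natAbs + (F 0).natAbs)
  obtain ⟨n, hn, g, hg, happrox⟩ := hc p (by omega) hp
  set m := p * f.natDegree with hm
  -- The conjugation-invariant sum of the approximants is a rational integer after scaling.
  obtain ⟨k, hk⟩ : ∃ k : ℤ, (k : K) = (b : K) ^ m * ∑ x ∈ S, (F x : K) * aeval x g := by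
    apply exists_intCast_eq_of_isIntegral_of_fixed
    · rw [Finset.mul_sum]
      refine IsIntegral.sum _ fun x hx => ?_
      rw [mul_left_comm]
      exact (isIntegral_algebraMap (R := ℤ) (A := K) (x := F x)).mul
        ((hint x hx).pow_mul_aeval g (hg.trans (Nat.sub_le _ _)))
    · intro σ
      rw [map_mul, map_pow, map_intCast, map_sum]
      congr 1
      refine Finset.sum_equiv σ.toEquiv (fun x => ?_) fun x _ => ?_
      · simp [hS, hF]
      · have : σ (aeval x g) = aeval (σ x) g :=
          (aeval_algHom_apply (σ.toAlgHom.restrictScalars ℤ) x g).symm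
        simp [hF, this]
  have hkC : (k : ℂ) = (b : ℂ) ^ m * ∑ x ∈ S, (F x : ℂ) * aeval (φ x) g := by
    have h := congrArg φ hk
    have hφ : ∀ x, φ (aeval x g) = aeval (φ x) g := fun x =>
      (aeval_algHom_apply φ.toIntAlgHom x g).symm
    simpa [hφ] using h
  have hNC : ((b ^ m * n * F 0 + p * k : ℤ) : ℂ)
      = -((b : ℂ) ^ m * ∑ x ∈ S, (F x : ℂ) * (n • Complex.exp (φ x) - p • aeval (φ x) g)) := by
    push_cast
    rw [hkC, eq_neg_of_add_eq_zero_left hrel]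
    simp only [zsmul_eq_mul, nsmul_eq_mul, mul_sub, Finset.sum_sub_distrib, mul_left_comm _ (n : ℂ),
      mul_left_comm _ (p : ℂ), ← Finset.mul_sum]
    ring
  have hlt : |((b ^ m * n * F 0 + p * k : ℤ) : ℝ)| < 1 := by
    rw [← Complex.norm_intCast, hNC, norm_neg, norm_mul, norm_pow, Complex.norm_intCast]
    refine lt_of_le_of_lt (mul_le_mul_of_nonneg_left ?_ (by positivity)) hsmall
    rw [Finset.sum_mul]
    refine (norm_sum_le _ _).trans (Finset.sum_le_sum fun x hx => ?_)
    rw [norm_mul, Complex.norm_intCast]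
    refine mul_le_mul_of_nonneg_left (happrox ?_) (abs_nonneg _)
    rw [mem_aroots]
    refine ⟨hfne, ?_⟩
    have h := aeval_algHom_apply φ.toIntAlgHom x f
    rw [hroot x hx, map_zero] at h
    exact h
  -- An integer of absolute value below `1` vanishes, so `p` divides `b ^ m * n * F 0`.
  have hzero : b ^ m * n * F 0 + p * k = 0 := by
    rw [← Int.abs_lt_one_iff]
    exact_mod_cast hlt
  have hdvd : (p : ℤ) ∣ b ^ m * n * F 0 :=
    (Int.dvd_add_left (dvd_mul_right _ _)).mp (hzero ▸ dvd_zero _)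
  have hpi : Prime (p : ℤ) := Nat.prime_iff_prime_int.mp hp
  have hnd : ∀ z : ℤ, z ≠ 0 → z.natAbs < p → ¬ (p : ℤ) ∣ z := fun z hz hlt h =>
    absurd (Nat.le_of_dvd (Int.natAbs_pos.mpr hz) (Int.natCast_dvd.mp h)) (by omega)
  rcases hpi.dvd_or_dvd hdvd with h | h
  · rcases hpi.dvd_or_dvd h with h | h
    · exact hnd b hb0 (by omega) (hpi.dvd_of_dvd_pow h)
    · exact hn h
  · exact hnd _ h0 (by omega) h

/-! ### Passing to an invariant relation in the group ring -/

namespace AddMonoidAlgebra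

/-- The ring homomorphism from the integral group ring of the additive group of `K` to `ℂ` that
sends the basis element of `x : K` to `exp (φ x)`. -/
noncomputable def expEval {K : Type*} [Field K] (φ : K →+* ℂ) : AddMonoidAlgebra ℤ K →ₐ[ℤ] ℂ :=
  lift ℤ ℂ K (Complex.expMonoidHom.comp (AddMonoidHom.toMultiplicative φ.toAddMonoidHom))

theorem expEval_single {K : Type*} [Field K] (φ : K →+* ℂ) (x : K) (c : ℤ) :
    expEval φ (single x c) = c * Complex.exp (φ x) := by
  simp [expEval]

theorem expEval_eq_sum {K : Type*} [Field K] (φ : K →+* ℂ) (F : AddMonoidAlgebra ℤ K) :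
    expEval φ F = F.coeff.sum (fun x c => (c : ℂ) * Complex.exp (φ x)) := by
  simp [expEval, lift_apply]

/-- The action of the Galois group of `K` over `ℚ` on the integral group ring of the additive group
of `K`, by permutation of the basis. -/
noncomputable def galConj {K : Type*} [Field K] [Algebra ℚ K] (σ : K ≃ₐ[ℚ] K) :
    AddMonoidAlgebra ℤ K ≃+* AddMonoidAlgebra ℤ K :=
  mapDomainRingEquiv ℤ (σ : K ≃+ K)

theorem galConj_single {K : Type*} [Field K] [Algebra ℚ K] (σ : K ≃ₐ[ℚ] K) (x : K) (c : ℤ) :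
    galConj σ (single x c) = single (σ x) c :=
  mapDomainRingEquiv_single ..

theorem galConj_galConj {K : Type*} [Field K] [Algebra ℚ K] (σ τ : K ≃ₐ[ℚ] K)
    (F : AddMonoidAlgebra ℤ K) : galConj σ (galConj τ F) = galConj (σ * τ) F := by
  ext x
  simp only [galConj, coeff_mapDomainRingEquiv]
  rfl

theorem coeff_galConj {K : Type*} [Field K] [Algebra ℚ K] (σ : K ≃ₐ[ℚ] K)
    (F : AddMonoidAlgebra ℤ K) (x : K) : (galConj σ F).coeff (σ x) = F.coeff x := by
  simp [galConj]

theorem coeff_apply_eq_of_galConj_eq {K : Type*} [Field K] [Algebra ℚ K] {F : AddMonoidAlgebra ℤ K}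
    (hF : ∀ σ : K ≃ₐ[ℚ] K, galConj σ F = F) (σ : K ≃ₐ[ℚ] K) (x : K) :
    F.coeff (σ x) = F.coeff x := by
  rw [← coeff_galConj σ F x, hF]

/-- For a Galois-invariant `F`, multiplication by the orbit sum of `-y`, where `y` is in the support
of `F`, makes the coefficient at `0` nonzero: it collects the equal coefficients of `F` at all the
conjugates of `y`. -/
theorem expEval_ne_zero_of_galConj_eq {K : Type*} [Field K] [Algebra ℚ K] [FiniteDimensional ℚ K]
    [IsGalois ℚ K] (φ : K →+* ℂ) {F : AddMonoidAlgebra ℤ K} (hF0 : F ≠ 0)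
    (hF : ∀ σ : K ≃ₐ[ℚ] K, galConj σ F = F) : expEval φ F ≠ 0 := by
  classical
  obtain ⟨y, hy⟩ : ∃ y, F.coeff y ≠ 0 := by
    by_contra! h
    exact hF0 (by ext x; simp [h])
  set T : AddMonoidAlgebra ℤ K := ∑ τ : K ≃ₐ[ℚ] K, single (τ (-y)) 1 with hT
  have hTinv : ∀ σ : K ≃ₐ[ℚ] K, galConj σ T = T := by
    intro σ
    rw [hT, map_sum]
    refine Fintype.sum_equiv (Equiv.mulLeft σ) _ _ fun τ => ?_
    rw [galConj_single]
    rfl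
  have hcoeff : (F * T).coeff 0 = Fintype.card (K ≃ₐ[ℚ] K) * F.coeff y := by
    have key : ∀ τ : K ≃ₐ[ℚ] K, (F * single (τ (-y)) 1).coeff 0 = F.coeff y := by
      intro τ
      rw [coeff_mul_single_apply, mul_one, map_neg, neg_neg, zero_add,
        coeff_apply_eq_of_galConj_eq hF]
    rw [hT, Finset.mul_sum, coeff_sum, Finsupp.finsetSum_apply,
      Finset.sum_congr rfl fun τ _ => key τ]
    simp
  have hne := sum_exp_ne_zero_of_galois_invariant φ (F * T).coeff
    (coeff_apply_eq_of_galConj_eq fun σ => by rw [map_mul, hF, hTinv])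
    (by rw [hcoeff]; exact mul_ne_zero (by exact_mod_cast Fintype.card_ne_zero) hy)
  rw [← expEval_eq_sum, map_mul] at hne
  exact left_ne_zero_of_mul hne

/-- Distinct elements of a Galois number field have exponentials that are linearly independent over
`ℤ`. The general case follows from the invariant one by taking the product of all conjugates. -/
theorem expEval_ne_zero {K : Type*} [Field K] [Algebra ℚ K] [FiniteDimensional ℚ K]
    [IsGalois ℚ K] (φ : K →+* ℂ) {F : AddMonoidAlgebra ℤ K} (hF0 : F ≠ 0) : expEval φ F ≠ 0 := by
  classical
  have hprod : ∏ σ : K ≃ₐ[ℚ] K, galConj σ F ≠ 0 :=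
    Finset.prod_ne_zero_iff.mpr fun σ _ => (map_ne_zero_iff _ (galConj σ).injective).mpr hF0
  have hne := expEval_ne_zero_of_galConj_eq φ hprod fun σ => by
    rw [map_prod]
    refine Fintype.prod_equiv (Equiv.mulLeft σ) _ _ fun τ => ?_
    rw [galConj_galConj]
    rfl
  rw [map_prod] at hne
  have h1 := Finset.prod_ne_zero_iff.mp hne 1 (Finset.mem_univ _)
  have : galConj (1 : K ≃ₐ[ℚ] K) F = F := by
    ext x
    exact coeff_galConj 1 F x
  rwa [this] at h1

end AddMonoidAlgebra

open Polynomial in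
/-- The **Hermite–Lindemann theorem**. -/
theorem transcendental_exp_of_isAlgebraic {a : ℂ} (ha : IsAlgebraic ℚ a) (ha0 : a ≠ 0) :
    Transcendental ℚ (Complex.exp a) := by
  intro halg
  obtain ⟨P, hP0, hP⟩ : IsAlgebraic ℤ (Complex.exp a) :=
    (IsFractionRing.isAlgebraic_iff ℤ ℚ ℂ).mpr halg
  let K := IntermediateField.adjoin ℚ ((minpoly ℚ a).rootSet ℂ)
  have : (minpoly ℚ a).IsSplittingField ℚ K :=
    IntermediateField.adjoin_rootSet_isSplittingField (IsAlgClosed.splits _)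
  have : FiniteDimensional ℚ K := IsSplittingField.finiteDimensional K (minpoly ℚ a)
  have : IsGalois ℚ K :=
    IsGalois.of_separable_splitting_field (minpoly.irreducible ha.isIntegral).separable
  have haK : a ∈ K := IntermediateField.subset_adjoin _ _
    (mem_rootSet.mpr ⟨minpoly.ne_zero ha.isIntegral, minpoly.aeval ℚ a⟩)
  let x : K := ⟨a, haK⟩
  have hx0 : x ≠ 0 := fun h => ha0 (congrArg Subtype.val h)
  set F : AddMonoidAlgebra ℤ K := aeval (AddMonoidAlgebra.single x (1 : ℤ)) P with hF
  -- The multiples `i • x` are distinct, so the leading term of `P` cannot cancel.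
  have hcoeff : F.coeff (P.natDegree • x) = P.leadingCoeff := by
    rw [hF, aeval_eq_sum_range, AddMonoidAlgebra.coeff_sum, Finsupp.finsetSum_apply,
      Finset.sum_eq_single_of_mem P.natDegree (by simp)]
    · simp [AddMonoidAlgebra.single_pow]
    · intro i _ hi
      have : i • x ≠ P.natDegree • x := fun h => hi (by simpa [nsmul_eq_mul, hx0] using h)
      simp [AddMonoidAlgebra.single_pow, this, -nsmul_eq_mul]
  have hF0 : F ≠ 0 := by
    rintro h
    rw [h] at hcoeff
    exact hP0 (leadingCoeff_eq_zero.mp hcoeff.symm)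
  refine AddMonoidAlgebra.expEval_ne_zero (algebraMap K ℂ) hF0 ?_
  rw [hF, ← aeval_algHom_apply, AddMonoidAlgebra.expEval_single, Int.cast_one, one_mul]
  exact hP

/-! ### Values of the elementary functions at algebraic points -/

theorem isAlgebraic_I : IsAlgebraic ℚ Complex.I :=
  IsAlgebraic.of_pow two_pos (by simpa using isAlgebraic_one.neg)

theorem isAlgebraic_exp_mul_I_of_cos_of_sin {z : ℂ} (hc : IsAlgebraic ℚ (Complex.cos z))
    (hs : IsAlgebraic ℚ (Complex.sin z)) : IsAlgebraic ℚ (Complex.exp (z * Complex.I)) := by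
  rw [Complex.exp_mul_I]
  exact hc.add (hs.mul isAlgebraic_I)

theorem transcendental_cos_of_isAlgebraic {z : ℂ} (hz : IsAlgebraic ℚ z) (hz0 : z ≠ 0) :
    Transcendental ℚ (Complex.cos z) := by
  intro hc
  refine transcendental_exp_of_isAlgebraic (hz.mul isAlgebraic_I)
    (mul_ne_zero hz0 Complex.I_ne_zero) (isAlgebraic_exp_mul_I_of_cos_of_sin hc ?_)
  refine IsAlgebraic.of_pow two_pos ?_
  rw [Complex.sin_sq]
  exact isAlgebraic_one.sub (hc.pow 2)

theorem transcendental_sin_of_isAlgebraic {z : ℂ} (hz : IsAlgebraic ℚ z) (hz0 : z ≠ 0) :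
    Transcendental ℚ (Complex.sin z) := by
  intro hs
  refine transcendental_cos_of_isAlgebraic hz hz0 (IsAlgebraic.of_pow two_pos ?_)
  rw [Complex.cos_sq']
  exact isAlgebraic_one.sub (hs.pow 2)

theorem transcendental_tan_of_isAlgebraic {z : ℂ} (hz : IsAlgebraic ℚ z) (hz0 : z ≠ 0)
    (hcos : Complex.cos z ≠ 0) : Transcendental ℚ (Complex.tan z) := by
  intro ht
  refine transcendental_cos_of_isAlgebraic hz hz0 (IsAlgebraic.of_pow two_pos ?_)
  rw [← Complex.inv_one_add_tan_sq hcos]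
  exact (isAlgebraic_one.add (ht.pow 2)).inv

theorem transcendental_cot_of_isAlgebraic {z : ℂ} (hz : IsAlgebraic ℚ z) (hz0 : z ≠ 0)
    (hsin : Complex.sin z ≠ 0) : Transcendental ℚ (Complex.cot z) := by
  intro ht
  refine transcendental_sin_of_isAlgebraic hz hz0 (IsAlgebraic.of_pow two_pos ?_)
  have : Complex.sin z ^ 2 = (1 + Complex.cot z ^ 2)⁻¹ := by
    have h1 : (1 + Complex.cot z ^ 2) * Complex.sin z ^ 2 = 1 := by
      rw [Complex.cot_eq_cos_div_sin, add_mul, one_mul, ← mul_pow, div_mul_cancel₀ _ hsin,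
        Complex.sin_sq_add_cos_sq]
    exact eq_inv_of_mul_eq_one_right h1
  rw [this]
  exact (isAlgebraic_one.add (ht.pow 2)).inv

/-- Every function of the list takes a transcendental value at a nonzero algebraic point of its
domain, except for the principal branch of the logarithm at `1`. -/
theorem ElemFun.transcendental_eval {f : ElemFun} {z : ℂ} (hz : IsAlgebraic ℚ z)
    (hdom : z ∈ f.domain) (hz0 : z ≠ 0) (hz1 : f = ElemFun.log 0 → z ≠ 1) :
    Transcendental ℚ (f.eval z) := by
  have hzI := hz.mul isAlgebraic_I
  have hzI0 := mul_ne_zero hz0 Complex.I_ne_zero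
  cases f with
  | exp => exact transcendental_exp_of_isAlgebraic hz hz0
  | log k =>
    intro hlog
    have hexp : Complex.exp ((log k).eval z) = z := by
      have h : 2 * Real.pi * Complex.I * k = k * (2 * Real.pi * Complex.I) := by ring
      rw [eval, h, Complex.exp_add, Complex.exp_int_mul_two_pi_mul_I, mul_one, Complex.exp_log hz0]
    by_cases h0 : (log k).eval z = 0
    -- A zero of a branch of the logarithm is at `1`, and then the branch is the principal one.
    · have hone : z = 1 := by rw [← hexp, h0, Complex.exp_zero]
      have hk : k = 0 := by
        simpa [eval, hone, Complex.I_ne_zero, Real.pi_ne_zero] using h0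
      exact hz1 (by rw [hk]) hone
    · exact transcendental_exp_of_isAlgebraic hlog h0 (by rwa [hexp])
  | sin => exact transcendental_sin_of_isAlgebraic hz hz0
  | cos => exact transcendental_cos_of_isAlgebraic hz hz0
  | tan => exact transcendental_tan_of_isAlgebraic hz hz0 hdom
  | csc =>
    intro h
    exact transcendental_sin_of_isAlgebraic hz hz0 (by simpa [eval] using h.inv)
  | sec =>
    intro h
    exact transcendental_cos_of_isAlgebraic hz hz0 (by simpa [eval] using h.inv)
  | cot => exact transcendental_cot_of_isAlgebraic hz hz0 hdom
  | sinh =>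
    intro h
    refine transcendental_sin_of_isAlgebraic hzI hzI0 ?_
    rw [Complex.sin_mul_I]
    exact h.mul isAlgebraic_I
  | cosh =>
    intro h
    refine transcendental_cos_of_isAlgebraic hzI hzI0 ?_
    rwa [Complex.cos_mul_I]
  | tanh =>
    intro h
    refine transcendental_tan_of_isAlgebraic hzI hzI0 ?_ ?_
    · rwa [Complex.cos_mul_I]
    · rw [Complex.tan_mul_I]
      exact h.mul isAlgebraic_I
  | coth =>
    intro h
    refine transcendental_cot_of_isAlgebraic hzI hzI0 ?_ ?_
    · rw [Complex.sin_mul_I]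
      exact mul_ne_zero hdom Complex.I_ne_zero
    · rw [Complex.cot_eq_cos_div_sin, Complex.cos_mul_I, Complex.sin_mul_I, ← div_div]
      exact h.mul isAlgebraic_I.inv

theorem theorem1 (f : ElemFun) (g h : Polynomial ℚ) (hg : 1 ≤ g.natDegree) (α : ℂ)
    (hα : f.IsSolution g h α) (h0 : α ≠ 0) (h1 : f = ElemFun.log 0 → α ≠ 1) :
    Transcendental ℚ α := by
  intro halg
  refine ElemFun.transcendental_eval halg hα.1 h0 h1 ?_
  refine IsAlgebraic.of_aeval g (by omega) ?_ ?_
  · exact mem_nonZeroDivisors_of_ne_zero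
      (Polynomial.leadingCoeff_ne_zero.mpr (Polynomial.ne_zero_of_natDegree_gt hg))
  · rw [hα.2]
    by_contra hh
    exact (transcendental_aeval_iff.mp hh).1 halg
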